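/- A root class of groups is a class of groups, closed under isomorphism, that contains a non-trivial group and is closed under taking subgroups and unrestricted wreath products. For a class of groups $\mathcal{C}$, let $\mathfrak{P}(\mathcal{C})$ be the set of all primes if $\mathcal{C}$ contains a non-periodic group, and otherwise the set of those primes that divide the order of an element of some group in $\mathcal{C}$. Let $Y$ be a subgroup of a group $X$. We say that $Y$ is $\mathcal{C}$-separable in $X$ if for each $x \in X \setminus Y$ there is a homomorphism $\sigma$ of $X$ onto a group from $\mathcal{C}$ such that $\sigma(x) \notin \sigma(Y)$; that $X$ is residually a $\mathcal{C}$-group if its trivial subgroup is $\mathcal{C}$-separable; that $Y$ is $\mathfrak{P}(\mathcal{C})'$-isolated in $X$ if, for each $x \in X$ and each prime $q \notin \mathfrak{P}(\mathcal{C})$, $x^q \in Y$ implies $x \in Y$; and that $Y$ is $\mathcal{C}$-defective in $X$ if it is $\mathfrak{P}(\mathcal{C})'$-isolated but not $\mathcal{C}$-separable in $X$. Suppose that $\mathcal{C}$ is a root class of groups and that $G$ is the free product of a family of groups $A_i$ $(i \in \mathcal{I})$, each of which is residually a $\mathcal{C}$-group. Then a cyclic subgroup $H$ of $G$ is $\mathcal{C}$-defective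 in $G$ if and only if, for some $i \in \mathcal{I}$, it is conjugate in $G$ to a cyclic subgroup of $A_i$ that is $\mathcal{C}$-defective in $A_i$. In particular, if in every group $A_i$ $(i \in \mathcal{I})$ all $\mathfrak{P}(\mathcal{C})'$-isolated cyclic subgroups are $\mathcal{C}$-separable, then all $\mathfrak{P}(\mathcal{C})'$-isolated cyclic subgroups of $G$ are $\mathcal{C}$-separable in $G$. -/

import Mathlib

universe u

/-- A class of groups: a predicate on all groups of the universe `u`. -/
abbrev GroupClass : Type (u + 1) := ∀ (X : Type u) [Group X], Prop

namespace GroupClass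

/-- A root class of groups: a class (closed under isomorphism, as every class of groups is) that
contains a nontrivial group and is closed under taking subgroups and unrestricted wreath products.
Mathlib's `X ≀ᵣ Y` is the unrestricted wreath product: its base is the group of all functions
`Y → X`. -/
structure IsRoot (C : GroupClass.{u}) : Prop where
  of_mulEquiv : ∀ (X Y : Type u) [Group X] [Group Y], (X ≃* Y) → C X → C Y
  exists_nontrivial : ∃ (X : Type u) (_ : Group X), C X ∧ Nontrivial X
  subgroup : ∀ (X : Type u) [Group X] (Y : Subgroup X), C X → C Y
  wreath : ∀ (X Y : Type u) [Group X] [Group Y], C X → C Y → C (X ≀ᵣ Y)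

/-- The set of primes `𝔓(C)`: all primes if some group of the class is not periodic; otherwise the
primes that divide the order of an element of some group of the class. -/
def primes (C : GroupClass.{u}) : Set ℕ :=
  {p | p.Prime ∧
    ((∃ (X : Type u) (_ : Group X), C X ∧ ∃ x : X, ¬ IsOfFinOrder x) ∨
      ∃ (X : Type u) (_ : Group X), C X ∧ ∃ x : X, p ∣ orderOf x)}

/-- `Y` is `C`-separable in `X`: each `x ∉ Y` is mapped outside the image of `Y` by some
homomorphism of `X` onto a group of the class `C`. -/
def Separable (C : GroupClass.{u}) {X : Type u} [Group X] (Y : Subgroup X) : Prop :=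
  ∀ x : X, x ∉ Y → ∃ (Z : Type u) (_ : Group Z) (σ : X →* Z),
    C Z ∧ Function.Surjective σ ∧ σ x ∉ Y.map σ

/-- `X` is residually a `C`-group: each nontrivial element is mapped to a nontrivial element by
some homomorphism of `X` onto a group of the class `C`. -/
def Residually (C : GroupClass.{u}) (X : Type u) [Group X] : Prop :=
  ∀ x : X, x ≠ 1 → ∃ (Z : Type u) (_ : Group Z) (σ : X →* Z),
    C Z ∧ Function.Surjective σ ∧ σ x ≠ 1

/-- `Y` is `𝔓(C)'`-isolated in `X`: for each prime `q ∉ 𝔓(C)`, if `x ^ q ∈ Y` then `x ∈ Y`. -/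
def Isolated (C : GroupClass.{u}) {X : Type u} [Group X] (Y : Subgroup X) : Prop :=
  ∀ (x : X) (q : ℕ), q.Prime → q ∉ C.primes → x ^ q ∈ Y → x ∈ Y

/-- `Y` is `C`-defective in `X`: it is `𝔓(C)'`-isolated but not `C`-separable in `X`. -/
def Defective (C : GroupClass.{u}) {X : Type u} [Group X] (Y : Subgroup X) : Prop :=
  C.Isolated Y ∧ ¬ C.Separable Y

end GroupClass

namespace GroupClass

/-! ### Root classes, residual properties and retracts. -/

section Basic

variable {C : GroupClass.{u}}

/-! A generator of `H` is trivial, conjugate into a factor, or conjugate to a cyclically reduced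
element. Free products inherit residuality, so the trivial subgroup is separable. A conjugate of a
factor is a retract of `G`, and defectiveness passes both ways along a retract
(`Residually.defective_map_iff`). What remains is that an isolated `⟨h⟩` with `h` cyclically reduced
is separable (`IsRoot.separable_zpowers_listProd`).

If `x` does not commute with `h`, a quotient separating `x * h` from `h * x` suffices. Otherwise `x
= r ^ a` and `⟨h⟩ = ⟨r ^ b⟩` with `r` cyclically reduced and `b ∤ a`. Some prime power `p ^ k`
divides `b` but not `a`, isolation forces `p ∈ 𝔓(C)`, and a quotient where `p ^ k` divides the order
of `r` separates.

Such quotients come from iterated wreath products (`IsRoot.exists_noCoprimeTorsionOn_ker`). They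
keep a given alternating product nontrivial and create no torsion prime to `p` on the kernel of a
chosen map `ψ`. The same lemma gives residuality of `G`. -/

theorem IsRoot.of_injective (hC : C.IsRoot) {X Y : Type u} [Group X] [Group Y] (f : X →* Y)
    (hf : Function.Injective f) (hY : C Y) : C X :=
  hC.of_mulEquiv _ _ (MonoidHom.ofInjective hf).symm (hC.subgroup Y f.range hY)

theorem IsRoot.prod (hC : C.IsRoot) {X Y : Type u} [Group X] [Group Y] (hX : C X) (hY : C Y) :
    C (X × Y) := by
  -- Constant functions are fixed by the top group, so together with it they form a direct product.
  let f : X × Y →* X ≀ᵣ Y :=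
    { toFun := fun z => ⟨fun _ => z.1, z.2⟩
      map_one' := rfl
      map_mul' := fun _ _ => rfl }
  refine hC.of_injective f (fun a b h => ?_) (hC.wreath X Y hX hY)
  have h1 : (f a).left 1 = (f b).left 1 := by rw [h]
  have h2 : (f a).right = (f b).right := by rw [h]
  exact Prod.ext h1 h2

theorem IsRoot.separable_of_forall (hC : C.IsRoot) {X : Type u} [Group X] {Y : Subgroup X}
    (h : ∀ x : X, x ∉ Y → ∃ (Z : Type u) (_ : Group Z) (σ : X →* Z), C Z ∧ ∀ y ∈ Y, σ y ≠ σ x) :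
    C.Separable Y := by
  intro x hx
  obtain ⟨Z, _, σ, hZ, hσ⟩ := h x hx
  refine ⟨σ.range, inferInstance, σ.rangeRestrict, hC.subgroup Z _ hZ,
    σ.rangeRestrict_surjective, ?_⟩
  rintro ⟨y, hy, hyx⟩
  exact hσ y hy (congrArg Subtype.val hyx)

theorem IsRoot.residually_of_forall (hC : C.IsRoot) {X : Type u} [Group X]
    (h : ∀ x : X, x ≠ 1 → ∃ (Z : Type u) (_ : Group Z) (σ : X →* Z), C Z ∧ σ x ≠ 1) :
    C.Residually X := by
  intro x hx
  obtain ⟨Z, _, σ, hZ, hσ⟩ := h x hx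
  refine ⟨σ.range, inferInstance, σ.rangeRestrict, hC.subgroup Z _ hZ,
    σ.rangeRestrict_surjective, fun h => hσ (congrArg Subtype.val h)⟩

theorem Residually.separable_bot {X : Type u} [Group X] (hX : C.Residually X) :
    C.Separable (⊥ : Subgroup X) := by
  intro x hx
  obtain ⟨Z, _, σ, hZ, hs, hσ⟩ := hX x hx
  exact ⟨Z, _, σ, hZ, hs, by simpa using hσ⟩

theorem Residually.exists_ne {X : Type u} [Group X] (hX : C.Residually X) {x y : X} (h : x ≠ y) :
    ∃ (Z : Type u) (_ : Group Z) (σ : X →* Z), C Z ∧ σ x ≠ σ y := by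
  obtain ⟨Z, _, σ, hZ, -, hσ⟩ := hX (x * y⁻¹) (by rwa [ne_eq, mul_inv_eq_one])
  exact ⟨Z, _, σ, hZ, by rwa [map_mul, map_inv, ne_eq, mul_inv_eq_one] at hσ⟩

/-- Elements of infinite order are covered: `orderOf` is then `0`, which every prime divides. -/
theorem coprime_orderOf_of_notMem_primes {q : ℕ} (hq : q.Prime) (hqC : q ∉ C.primes)
    {Z : Type u} [Group Z] (hZ : C Z) (z : Z) : q.Coprime (orderOf z) := by
  rw [hq.coprime_iff_not_dvd]
  exact fun h => hqC ⟨hq, Or.inr ⟨Z, _, hZ, z, h⟩⟩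

/-- In a residually `C`-group roots of degree `q ∉ 𝔓(C)` are unique. -/
theorem Residually.eq_of_pow_eq_pow {X : Type u} [Group X] (hX : C.Residually X) {q : ℕ}
    (hq : q.Prime) (hqC : q ∉ C.primes) {x y : X} (h : x ^ q = y ^ q) : x = y := by
  by_contra hne
  obtain ⟨Z, _, σ, hZ, hσ⟩ := hX.exists_ne hne
  apply hσ
  have hpow : σ x ^ q = σ y ^ q := by rw [← map_pow, ← map_pow, h]
  have hcop : IsCoprime (q : ℤ) ((orderOf (σ x) * orderOf (σ y) : ℕ) : ℤ) :=
    Nat.isCoprime_iff_coprime.2 ((coprime_orderOf_of_notMem_primes hq hqC hZ _).mul_right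
      (coprime_orderOf_of_notMem_primes hq hqC hZ _))
  obtain ⟨a, b, hab⟩ := hcop
  have key : ∀ z : Z, z ^ (orderOf (σ x) * orderOf (σ y)) = 1 → z = (z ^ q) ^ a := by
    intro z hz
    have : z ^ (a * (q : ℤ) + b * ((orderOf (σ x) * orderOf (σ y) : ℕ) : ℤ)) = (z ^ q) ^ a := by
      rw [zpow_add, mul_comm a, mul_comm b, zpow_mul, zpow_mul, zpow_natCast, zpow_natCast, hz,
        one_zpow, mul_one]
    rwa [hab, zpow_one] at this
  rw [key (σ x) (by rw [pow_mul, pow_orderOf_eq_one, one_pow]),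
    key (σ y) (by rw [mul_comm, pow_mul, pow_orderOf_eq_one, one_pow]), hpow]

/-- Defectiveness is preserved and reflected by the embedding of a retract into a residually
`C`-group. -/
theorem Residually.defective_map_iff (hC : C.IsRoot) {X Y : Type u} [Group X] [Group Y]
    (hX : C.Residually X) (ι : Y →* X) (ρ : X →* Y) (hρ : ∀ y, ρ (ι y) = y) (K : Subgroup Y) :
    C.Defective (K.map ι) ↔ C.Defective K := by
  have hι : Function.Injective ι := Function.LeftInverse.injective hρ
  refine and_congr ⟨fun h y q hq hqC hy => ?_, fun h x q hq hqC hx => ?_⟩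
    (not_congr ⟨fun h => hC.separable_of_forall fun y hy => ?_,
      fun h => hC.separable_of_forall fun x hx => ?_⟩)
  · have := h (ι y) q hq hqC (by rw [← map_pow]; exact Subgroup.mem_map_of_mem ι hy)
    rwa [Subgroup.mem_map_iff_mem hι] at this
  · obtain ⟨k, hk, hkx⟩ := hx
    have hk' : ρ x ^ q = k := by rw [← map_pow, ← hkx, hρ]
    have hxK : ρ x ∈ K := h _ q hq hqC (hk' ▸ hk)
    have : x = ι (ρ x) := hX.eq_of_pow_eq_pow hq hqC (by rw [← map_pow, hk', hkx])
    rw [this]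
    exact Subgroup.mem_map_of_mem ι hxK
  · obtain ⟨Z, _, σ, hZ, -, hσ⟩ := h (ι y) (by rwa [Subgroup.mem_map_iff_mem hι])
    exact ⟨Z, _, σ.comp ι, hZ, fun k hk hky =>
      hσ ⟨ι k, Subgroup.mem_map_of_mem ι hk, hky⟩⟩
  · by_cases hxK : ρ x ∈ K
    · have hne : x ≠ ι (ρ x) := fun h => hx (h ▸ Subgroup.mem_map_of_mem ι hxK)
      obtain ⟨Z, _, σ, hZ, hσ⟩ := hX.exists_ne hne
      -- The two coordinates agree on the image of `ι` and differ at `x`.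
      refine ⟨Z × Z, _, (σ.comp (ι.comp ρ)).prod σ, hC.prod hZ hZ, ?_⟩
      rintro _ ⟨k, -, rfl⟩ hk
      simp only [MonoidHom.prod_apply, MonoidHom.comp_apply, hρ, Prod.mk.injEq] at hk
      exact hσ (hk.2.symm.trans hk.1)
    · obtain ⟨Z, _, σ, hZ, -, hσ⟩ := h _ hxK
      refine ⟨Z, _, σ.comp ρ, hZ, ?_⟩
      rintro _ ⟨k, hk, rfl⟩ hkx
      rw [MonoidHom.comp_apply, hρ] at hkx
      exact hσ ⟨k, hk, hkx⟩

theorem IsRoot.exists_mem_primes (hC : C.IsRoot) : ∃ p, p ∈ C.primes := by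
  obtain ⟨X, _, hX, hn⟩ := hC.exists_nontrivial
  obtain ⟨x, hx⟩ := exists_ne (1 : X)
  obtain ⟨p, hp, hpx⟩ := Nat.exists_prime_and_dvd (mt orderOf_eq_one_iff.1 hx)
  exact ⟨p, hp, Or.inr ⟨X, _, hX, x, hpx⟩⟩

/-- A cyclic subgroup, infinite or of order `p`, will do. It supplies the base group of the wreath
products. -/
theorem IsRoot.exists_nontrivial_of_mem_primes (hC : C.IsRoot) {p : ℕ} (hp : p ∈ C.primes) :
    ∃ (D : Type u) (_ : Group D), C D ∧ Nontrivial D ∧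
      ∀ (d : D) (n : ℕ), n.Coprime p → d ^ n = 1 → d = 1 := by
  obtain ⟨hprime, hp⟩ := hp
  have key : ∃ (X : Type u) (_ : Group X), C X ∧ ∃ x : X, orderOf x = 0 ∨ orderOf x = p := by
    rcases hp with ⟨X, _, hX, x, hx⟩ | ⟨X, _, hX, x, hx⟩
    · exact ⟨X, _, hX, x, Or.inl (orderOf_eq_zero hx)⟩
    · by_cases h0 : orderOf x = 0
      · exact ⟨X, _, hX, x, Or.inl h0⟩
      · exact ⟨X, _, hX, _, Or.inr (orderOf_pow_orderOf_div h0 hx)⟩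
  obtain ⟨X, _, hX, x, hx⟩ := key
  refine ⟨Subgroup.zpowers x, inferInstance, hC.subgroup X _ hX, ?_, ?_⟩
  · rw [Subgroup.nontrivial_iff_ne_bot, ne_eq, Subgroup.zpowers_eq_bot, ← orderOf_eq_one_iff]
    have := hprime.one_lt
    omega
  · rintro ⟨_, m, rfl⟩ n hn h
    have h' : (x ^ m) ^ n = 1 := congrArg Subtype.val h
    refine Subtype.ext ?_
    change x ^ m = 1
    rcases hx with hx | hx
    · rw [← zpow_natCast, ← zpow_mul, ← orderOf_dvd_iff_zpow_eq_one, hx, Nat.cast_zero,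
        zero_dvd_iff, mul_eq_zero] at h'
      rcases h' with rfl | h'
      · exact zpow_zero x
      · rw [Nat.cast_eq_zero.1 h', Nat.coprime_zero_left] at hn
        exact absurd hn hprime.one_lt.ne'
    · have h1 := orderOf_dvd_of_pow_eq_one h'
      have h2 : orderOf (x ^ m) ∣ p := by
        apply orderOf_dvd_of_pow_eq_one
        rw [← zpow_natCast, ← zpow_mul, mul_comm, zpow_mul, zpow_natCast, ← hx,
          pow_orderOf_eq_one, one_zpow]
      exact orderOf_eq_one_iff.1 (Nat.dvd_one.1 (hn ▸ Nat.dvd_gcd h1 h2))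

/-- The restriction of `θ` to `N` has image without nontrivial elements of finite order prime
to `p`. -/
def NoCoprimeTorsionOn (p : ℕ) {X : Type u} [Group X] (N : Subgroup X) {L : Type u} [Group L]
    (θ : X →* L) : Prop :=
  ∀ x ∈ N, ∀ n : ℕ, n.Coprime p → θ x ^ n = 1 → θ x = 1

theorem IsRoot.exists_noCoprimeTorsionOn_forall_ne_one (hC : C.IsRoot) {p : ℕ} {X : Type u}
    [Group X] (N : Subgroup X) (l : List X)
    (h : ∀ x ∈ l, ∃ (L : Type u) (_ : Group L) (θ : X →* L),
      C L ∧ NoCoprimeTorsionOn p N θ ∧ θ x ≠ 1) :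
    ∃ (L : Type u) (_ : Group L) (θ : X →* L),
      C L ∧ NoCoprimeTorsionOn p N θ ∧ ∀ x ∈ l, θ x ≠ 1 := by
  induction l with
  | nil =>
    obtain ⟨L, _, hL, -⟩ := hC.exists_nontrivial
    exact ⟨L, _, 1, hL, fun _ _ _ _ _ => rfl, by simp⟩
  | cons a l ih =>
    obtain ⟨L₁, _, θ₁, hL₁, hθ₁, h₁⟩ := h a List.mem_cons_self
    obtain ⟨L₂, _, θ₂, hL₂, hθ₂, h₂⟩ := ih fun x hx => h x (List.mem_cons_of_mem _ hx)
    refine ⟨L₁ × L₂, _, θ₁.prod θ₂, hC.prod hL₁ hL₂, fun x hx n hn hxn => ?_, fun x hx hx1 => ?_⟩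
    · exact Prod.ext (hθ₁ x hx n hn (congrArg Prod.fst hxn))
        (hθ₂ x hx n hn (congrArg Prod.snd hxn))
    · rcases List.mem_cons.1 hx with rfl | hx
      · exact h₁ (congrArg Prod.fst hx1)
      · exact h₂ x hx (congrArg Prod.snd hx1)

theorem IsRoot.exists_forall_ne_one (hC : C.IsRoot) {X : Type u} [Group X] (l : List X)
    (h : ∀ x ∈ l, ∃ (L : Type u) (_ : Group L) (θ : X →* L), C L ∧ θ x ≠ 1) :
    ∃ (L : Type u) (_ : Group L) (θ : X →* L), C L ∧ ∀ x ∈ l, θ x ≠ 1 := by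
  -- On the trivial subgroup the torsion condition is vacuous, so any `p` serves.
  have hbot : ∀ {L : Type u} [Group L] (θ : X →* L), NoCoprimeTorsionOn 0 ⊥ θ := by
    rintro L _ θ x hx - - -
    rw [Subgroup.mem_bot.1 hx, map_one]
  obtain ⟨L, i, θ, hL, -, hθ⟩ := hC.exists_noCoprimeTorsionOn_forall_ne_one (p := 0) ⊥ l
    fun x hx => by
      obtain ⟨L, _, θ, hL, hθ⟩ := h x hx
      exact ⟨L, _, θ, hL, hbot θ, hθ⟩
  exact ⟨L, i, θ, hL, hθ⟩

end Basic

end GroupClass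

/-! ### Commuting lists. -/

namespace List

/-- Two commuting lists are powers of a common list. -/
theorem exists_flatten_replicate_of_append_comm {α : Type*} :
    ∀ {x y : List α}, x ++ y = y ++ x →
      ∃ (r : List α) (a b : ℕ), x = (replicate a r).flatten ∧ y = (replicate b r).flatten := by
  suffices H : ∀ (n : ℕ) (x y : List α), x.length + y.length ≤ n → x ++ y = y ++ x →
      ∃ (r : List α) (a b : ℕ), x = (replicate a r).flatten ∧ y = (replicate b r).flatten from
    fun {x y} h => H _ x y le_rfl h
  intro n
  induction n with
  | zero =>
    intro x y hn _
    obtain rfl : x = [] := length_eq_zero_iff.1 (by omega)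
    obtain rfl : y = [] := length_eq_zero_iff.1 (by omega)
    exact ⟨[], 0, 0, rfl, rfl⟩
  | succ n ih =>
    have main : ∀ x y : List α, x.length + y.length ≤ n + 1 → x.length ≤ y.length →
        x ++ y = y ++ x → ∃ (r : List α) (a b : ℕ),
          x = (replicate a r).flatten ∧ y = (replicate b r).flatten := by
      intro x y hn hle h
      rcases eq_or_ne x [] with rfl | hx
      · exact ⟨y, 0, 1, by simp, by simp⟩
      · have hpre : x <+: y :=
          prefix_of_prefix_length_le ⟨y, h⟩ (prefix_append y x) hle
        obtain ⟨z, rfl⟩ := hpre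
        have hpos := length_pos_iff.2 hx
        rw [length_append] at hn
        -- Euclid's algorithm: with the prefix `x` stripped from the longer list, the remainder
        -- still commutes with `x`.
        obtain ⟨r, a, b, ha, hb⟩ := ih x z (by omega) (by simpa using h)
        refine ⟨r, a, a + b, ha, ?_⟩
        rw [replicate_add, flatten_append, ← ha, ← hb]
    intro x y hn h
    rcases le_total x.length y.length with hle | hle
    · exact main x y hn hle h
    · obtain ⟨r, a, b, ha, hb⟩ := main y x (by omega) hle h.symm
      exact ⟨r, b, a, hb, ha⟩

theorem IsChain.flatten_replicate {α : Type*} {R : α → α → Prop} {l : List α}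
    (h : (l ++ l).IsChain R) (n : ℕ) : (replicate n l).flatten.IsChain R := by
  induction n with
  | zero => simp
  | succ n ih =>
    rw [replicate_succ, flatten_cons]
    cases n with
    | zero => simpa using (isChain_append.1 h).1
    | succ n =>
      rw [isChain_append] at h ⊢
      refine ⟨h.1, ih, fun x hx y hy => h.2.2 x hx y ?_⟩
      rcases eq_or_ne l [] with rfl | hl
      · simp at hx
      · rwa [replicate_succ, flatten_cons, head?_append_of_ne_nil _ hl] at hy

end List

/-! ### Reduced lists in free products. -/

namespace Monoid.CoprodI

variable {ι : Type*} {M : ι → Type*} [∀ i, Group (M i)]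

/-- The product in the free product of a list of letters, reduced or not. -/
def listProd (l : List (Σ i, M i)) : CoprodI M := (l.map fun a => of a.2).prod

@[simp]
theorem listProd_nil : listProd ([] : List (Σ i, M i)) = 1 := rfl

@[simp]
theorem listProd_cons (a : Σ i, M i) (l : List (Σ i, M i)) :
    listProd (a :: l) = of a.2 * listProd l := by simp [listProd]

@[simp]
theorem listProd_append (l l' : List (Σ i, M i)) :
    listProd (l ++ l') = listProd l * listProd l' := by simp [listProd]

theorem listProd_flatten_replicate (l : List (Σ i, M i)) (n : ℕ) :
    listProd (List.replicate n l).flatten = listProd l ^ n := by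
  induction n with
  | zero => simp
  | succ n ih => rw [List.replicate_succ, List.flatten_cons, listProd_append, ih, pow_succ']

/-- Adjacent letters lie in different factors. -/
abbrev IsAlternating (l : List (Σ i, M i)) : Prop := l.IsChain fun a b => a.1 ≠ b.1

/-- A list of nontrivial letters in which adjacent letters lie in different factors. -/
def IsReduced (l : List (Σ i, M i)) : Prop := (∀ a ∈ l, a.2 ≠ 1) ∧ IsAlternating l

theorem IsReduced.eq_of_listProd_eq {l l' : List (Σ i, M i)} (h : IsReduced l)
    (h' : IsReduced l') (heq : listProd l = listProd l') : l = l' := by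
  classical
  have : (⟨l, h.1, h.2⟩ : Word M) = ⟨l', h'.1, h'.2⟩ := Word.equiv.symm.injective heq
  exact congrArg Word.toList this

theorem exists_isReduced_length_le (l : List (Σ i, M i)) :
    ∃ l' : List (Σ i, M i), IsReduced l' ∧ listProd l' = listProd l ∧ l'.length ≤ l.length := by
  induction l with
  | nil => exact ⟨[], ⟨by simp, .nil⟩, rfl, le_rfl⟩
  | cons a l ih =>
    obtain ⟨t, ht, hprod, hlen⟩ := ih
    obtain ⟨i, a⟩ := a
    by_cases ha : a = 1
    · subst ha
      exact ⟨t, ht, by simp [hprod], by simp; omega⟩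
    · cases t with
      | nil =>
        exact ⟨[⟨i, a⟩], ⟨by simpa using ha, .singleton _⟩, by simp [← hprod], by simp⟩
      | cons b t =>
        obtain ⟨j, b⟩ := b
        have htail : IsReduced t := ⟨fun c hc => ht.1 c (List.mem_cons_of_mem _ hc), ht.2.tail⟩
        simp only [List.length_cons] at hlen
        by_cases hij : i = j
        · subst hij
          by_cases hab : a * b = 1
          · refine ⟨t, htail, ?_, by simp; omega⟩
            rw [listProd_cons, ← hprod, listProd_cons, ← mul_assoc, ← map_mul, hab, map_one,
              one_mul]
          · refine ⟨⟨i, a * b⟩ :: t, ⟨?_, ?_⟩, ?_, by simp; omega⟩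
            · simp only [List.mem_cons, forall_eq_or_imp]
              exact ⟨hab, htail.1⟩
            · have := ht.2
              rw [IsAlternating, List.isChain_cons] at this ⊢
              exact this
            · rw [listProd_cons, listProd_cons, ← hprod, listProd_cons, map_mul, mul_assoc]
        · refine ⟨⟨i, a⟩ :: ⟨j, b⟩ :: t, ⟨?_, ?_⟩, ?_, by simp; omega⟩
          · rw [List.forall_mem_cons]
            exact ⟨ha, ht.1⟩
          · exact List.isChain_cons_cons.2 ⟨hij, ht.2⟩
          · rw [listProd_cons, hprod, listProd_cons]

theorem exists_isReduced (x : CoprodI M) :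
    ∃ l : List (Σ i, M i), IsReduced l ∧ listProd l = x := by
  classical
  exact ⟨(Word.equiv x).toList, ⟨(Word.equiv x).ne_one, (Word.equiv x).chain_ne⟩,
    Word.equiv.symm_apply_apply x⟩

theorem IsReduced.length_le {l l' : List (Σ i, M i)} (h : IsReduced l)
    (heq : listProd l = listProd l') : l.length ≤ l'.length := by
  obtain ⟨t, ht, hprod, hlen⟩ := exists_isReduced_length_le l'
  rwa [h.eq_of_listProd_eq ht (heq.trans hprod.symm)]

theorem IsReduced.append {l l' : List (Σ i, M i)} (h : IsReduced l) (h' : IsReduced l')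
    (hne : ∀ a ∈ l.getLast?, ∀ b ∈ l'.head?, a.1 ≠ b.1) : IsReduced (l ++ l') :=
  ⟨fun a ha => (List.mem_append.1 ha).elim (h.1 a) (h'.1 a),
    List.isChain_append.2 ⟨h.2, h'.2, hne⟩⟩

/-- If the product of two reduced lists can be written with as many letters as they have together,
then their concatenation is reduced. -/
theorem IsReduced.append_of_length_le {l l' : List (Σ i, M i)} (h : IsReduced l)
    (h' : IsReduced l')
    (hlen : ∀ t : List (Σ i, M i), listProd t = listProd (l ++ l') →
      l.length + l'.length ≤ t.length) : IsReduced (l ++ l') := by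
  refine h.append h' ?_
  rintro ⟨i, a⟩ ha ⟨j, b⟩ hb hij
  change i = j at hij
  subst hij
  obtain ⟨s, rfl⟩ := List.getLast?_eq_some_iff.1 ha
  obtain ⟨s', rfl⟩ := List.head?_eq_some_iff.1 hb
  -- Two adjacent letters from one factor would merge and save a letter.
  have := hlen (s ++ ⟨i, a * b⟩ :: s') (by simp [mul_assoc])
  simp only [List.length_append, List.length_cons, List.length_nil] at this
  omega

/-- Reduced lists are shortest, so the other concatenation, having the same product and length,
admits no merging. It is reduced too, and normal forms are unique. -/
theorem IsReduced.append_comm {l l' : List (Σ i, M i)} (h : IsReduced l) (h' : IsReduced l')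
    (happ : IsReduced (l ++ l')) (hcomm : Commute (listProd l) (listProd l')) :
    l ++ l' = l' ++ l := by
  have heq : listProd (l ++ l') = listProd (l' ++ l) := by
    rw [listProd_append, listProd_append, hcomm.eq]
  refine happ.eq_of_listProd_eq (h'.append_of_length_le h fun t ht => ?_) heq
  have := happ.length_le (heq.trans ht.symm)
  rw [List.length_append] at this
  omega

/-- The list of inverses in the reverse order. -/
def invList (l : List (Σ i, M i)) : List (Σ i, M i) :=
  (l.map fun a => (⟨a.1, a.2⁻¹⟩ : Σ i, M i)).reverse

theorem listProd_invList (l : List (Σ i, M i)) : listProd (invList l) = (listProd l)⁻¹ := by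
  induction l with
  | nil => simp [invList]
  | cons a l ih =>
    simp only [invList, List.map_cons, List.reverse_cons, listProd_append] at ih ⊢
    rw [ih]
    simp

theorem isAlternating_invList {l : List (Σ i, M i)} (h : IsAlternating l) :
    IsAlternating (invList l) := by
  rw [IsAlternating, invList, List.isChain_reverse, List.isChain_map]
  exact h.imp fun _ _ h => h.symm

theorem IsReduced.invList {l : List (Σ i, M i)} (h : IsReduced l) : IsReduced (invList l) := by
  refine ⟨?_, isAlternating_invList h.2⟩
  intro a ha
  simp only [CoprodI.invList, List.mem_reverse, List.mem_map] at ha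
  obtain ⟨b, hb, rfl⟩ := ha
  exact inv_ne_one.2 (h.1 b hb)

/-! ### Cyclically reduced lists and their centralizers. -/

/-- A nonempty list all of whose powers are reduced. -/
structure IsCyclicallyReduced (l : List (Σ i, M i)) : Prop where
  ne_nil : l ≠ []
  reduced : IsReduced (l ++ l)

namespace IsCyclicallyReduced

variable {l : List (Σ i, M i)}

theorem isReduced (h : IsCyclicallyReduced l) : IsReduced l :=
  ⟨fun a ha => h.reduced.1 a (List.mem_append_left _ ha), (List.isChain_append.1 h.reduced.2).1⟩

theorem isReduced_flatten_replicate (h : IsCyclicallyReduced l) (n : ℕ) :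
    IsReduced (List.replicate n l).flatten := by
  refine ⟨fun a ha => ?_, h.reduced.2.flatten_replicate n⟩
  obtain ⟨t, ht, hat⟩ := List.mem_flatten.1 ha
  rw [List.eq_of_mem_replicate ht] at hat
  exact h.isReduced.1 a hat

theorem flatten_replicate_ne_nil (h : IsCyclicallyReduced l) {n : ℕ} (hn : n ≠ 0) :
    (List.replicate n l).flatten ≠ [] := by
  obtain ⟨m, rfl⟩ := Nat.exists_eq_succ_of_ne_zero hn
  rw [List.replicate_succ, List.flatten_cons]
  exact List.append_ne_nil_of_left_ne_nil h.ne_nil _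

theorem orderOf_listProd (h : IsCyclicallyReduced l) : orderOf (listProd l) = 0 := by
  rw [orderOf_eq_zero_iff']
  intro n hn h1
  rw [← listProd_flatten_replicate] at h1
  exact h.flatten_replicate_ne_nil hn.ne'
    ((h.isReduced_flatten_replicate n).eq_of_listProd_eq ⟨by simp, .nil⟩ h1)

theorem invList (h : IsCyclicallyReduced l) : IsCyclicallyReduced (invList l) := by
  refine ⟨by simpa [CoprodI.invList] using h.ne_nil, ?_⟩
  have := h.reduced.invList
  simpa [CoprodI.invList] using this

/-- A list of which some power is cyclically reduced is cyclically reduced. -/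
theorem of_flatten_replicate {r : List (Σ i, M i)} {n : ℕ}
    (h : IsCyclicallyReduced (List.replicate n r).flatten) : IsCyclicallyReduced r := by
  have hn : n ≠ 0 := by
    rintro rfl
    exact h.ne_nil (by simp)
  obtain ⟨m, rfl⟩ := Nat.exists_eq_succ_of_ne_zero hn
  refine ⟨?_, ?_⟩
  · rintro rfl
    exact h.ne_nil (by simp)
  · have h2 := h.reduced
    rw [← List.flatten_append, ← List.replicate_add,
      show m.succ + m.succ = m + m + 1 + 1 by omega, List.replicate_succ, List.flatten_cons,
      List.replicate_succ, List.flatten_cons, ← List.append_assoc] at h2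
    exact ⟨fun a ha => h2.1 a (List.mem_append_left _ ha), (List.isChain_append.1 h2.2).1⟩

/-- An element that commutes with a cyclically reduced one lies together with it or its inverse in
a cyclic semigroup with cyclically reduced generator. -/
theorem exists_pow_of_commute (h : IsCyclicallyReduced l) {x : CoprodI M}
    (hx : Commute x (listProd l)) :
    ∃ (r : List (Σ i, M i)) (a b : ℕ), IsCyclicallyReduced r ∧ x = listProd r ^ a ∧ b ≠ 0 ∧
      (listProd l = listProd r ^ b ∨ (listProd l)⁻¹ = listProd r ^ b) := by
  have main : ∀ {l t : List (Σ i, M i)}, IsCyclicallyReduced l → IsReduced t →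
      IsReduced (t ++ l) → Commute (listProd t) (listProd l) →
      ∃ (r : List (Σ i, M i)) (a b : ℕ), IsCyclicallyReduced r ∧
        listProd t = listProd r ^ a ∧ b ≠ 0 ∧ listProd l = listProd r ^ b := by
    intro l t hl ht htl hcomm
    obtain ⟨r, a, b, rfl, rfl⟩ := List.exists_flatten_replicate_of_append_comm
      (ht.append_comm hl.isReduced htl hcomm)
    refine ⟨r, a, b, hl.of_flatten_replicate, listProd_flatten_replicate r a, ?_,
      listProd_flatten_replicate r b⟩
    rintro rfl
    exact hl.ne_nil (by simp)
  obtain ⟨t, ht, rfl⟩ := exists_isReduced x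
  by_cases htl : ∀ a ∈ t.getLast?, ∀ b ∈ l.head?, a.1 ≠ b.1
  · obtain ⟨r, a, b, hr, ha, hb, hl⟩ := main h ht (ht.append h.isReduced htl) hx
    exact ⟨r, a, b, hr, ha, hb, Or.inl hl⟩
  · push Not at htl
    obtain ⟨a, ha, b, hb, hab⟩ := htl
    -- The first and last letters of `l` lie in different factors, so if `t` clashes with the first
    -- letter of `l`, it does not clash with the inverse of the last.
    have hinv : ∀ a ∈ t.getLast?, ∀ b ∈ (CoprodI.invList l).head?, a.1 ≠ b.1 := by
      intro a' ha' b' hb' hab'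
      simp only [CoprodI.invList, List.head?_reverse, List.getLast?_map, Option.mem_def,
        Option.map_eq_some_iff] at hb'
      obtain ⟨c, hc, rfl⟩ := hb'
      obtain rfl : a = a' := Option.mem_unique ha ha'
      exact (List.isChain_append.1 h.reduced.2).2.2 c hc b hb (hab'.symm.trans hab)
    obtain ⟨r, a, b, hr, ha, hb, hl⟩ := main h.invList ht (ht.append h.invList.isReduced hinv)
      (by rw [listProd_invList]; exact hx.inv_right)
    exact ⟨r, a, b, hr, ha, hb, Or.inr (by rw [← hl, listProd_invList])⟩

end IsCyclicallyReduced

theorem exists_conj_of_or_isCyclicallyReduced (x : CoprodI M) :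
    x = 1 ∨ (∃ (i : ι) (a : M i) (c : CoprodI M), x = c * of a * c⁻¹) ∨
      ∃ (l : List (Σ i, M i)) (c : CoprodI M),
        IsCyclicallyReduced l ∧ x = c * listProd l * c⁻¹ := by
  suffices H : ∀ (n : ℕ) (l : List (Σ i, M i)), l.length ≤ n → listProd l = 1 ∨
      (∃ (i : ι) (a : M i) (c : CoprodI M), listProd l = c * of a * c⁻¹) ∨
      ∃ (l' : List (Σ i, M i)) (c : CoprodI M),
        IsCyclicallyReduced l' ∧ listProd l = c * listProd l' * c⁻¹ by
    obtain ⟨l, -, rfl⟩ := exists_isReduced x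
    exact H _ l le_rfl
  intro n
  induction n with
  | zero =>
    intro l hl
    obtain rfl : l = [] := List.length_eq_zero_iff.1 (by omega)
    exact Or.inl rfl
  | succ n ih =>
    intro l hl
    obtain ⟨t, ht, hprod, hlen⟩ := exists_isReduced_length_le l
    rw [← hprod]
    cases t with
    | nil => exact Or.inl rfl
    | cons a t =>
      rcases List.eq_nil_or_concat t with rfl | ⟨s, b, rfl⟩
      · exact Or.inr (Or.inl ⟨a.1, a.2, 1, by simp⟩)
      · by_cases hab : b.1 = a.1
        · obtain ⟨i, a⟩ := a
          obtain ⟨j, b⟩ := b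
          change j = i at hab
          subst hab
          -- Conjugation moves the last letter to the front, where it merges with the first and
          -- shortens the list.
          have hs : listProd (⟨j, a⟩ :: (s ++ [⟨j, b⟩])) =
              (of b)⁻¹ * listProd (⟨j, b * a⟩ :: s) * of b := by
            simp [mul_assoc]
          simp only [List.concat_eq_append, List.length_cons, List.length_append,
            List.length_nil] at hlen
          rw [List.concat_eq_append, hs]
          rcases ih (⟨j, b * a⟩ :: s) (by simp; omega) with h | ⟨i, d, c, h⟩ | ⟨l', c, hl', h⟩
          · exact Or.inl (by rw [h]; simp)
          · exact Or.inr (Or.inl ⟨i, d, (of b)⁻¹ * c, by rw [h]; simp [mul_assoc]⟩)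
          · exact Or.inr (Or.inr ⟨l', (of b)⁻¹ * c, hl', by rw [h]; simp [mul_assoc]⟩)
        · refine Or.inr (Or.inr ⟨_, 1, ⟨by simp, ht.append ht ?_⟩, by simp⟩)
          rw [List.concat_eq_append, ← List.cons_append, List.getLast?_append]
          simpa using hab

end Monoid.CoprodI

/-! ### Lifting homomorphisms to wreath products. -/

namespace GroupClass

open Monoid Monoid.CoprodI

section WreathLift

variable {I : Type u} {A : I → Type u} [∀ i, Group (A i)] {D L : Type u} [Group D] [Group L]

open Classical in
/-- The conjugating elements of `wreathLift`. -/
noncomputable def wreathTwist (L : Type u) [Group L] (j : I) (d : D) (i : I) : D ≀ᵣ L :=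
  ⟨if i = j then Pi.mulSingle 1 d else 1, 1⟩

/-- The lift of `θ : CoprodI A →* L` to the wreath product `D ≀ᵣ L` whose restriction to the factor
`A j` is conjugated by the function supported at `1` with value `d`. -/
noncomputable def wreathLift (θ : CoprodI A →* L) (j : I) (d : D) : CoprodI A →* D ≀ᵣ L :=
  lift fun i => (MulAut.conj (wreathTwist L j d i)).toMonoidHom.comp
    (RegularWreathProduct.inl.comp (θ.comp of))

theorem wreathLift_of (θ : CoprodI A →* L) (j : I) (d : D) {i : I} (a : A i) :
    wreathLift θ j d (of a) =
      wreathTwist L j d i * RegularWreathProduct.inl (θ (of a)) * (wreathTwist L j d i)⁻¹ := by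
  simp [wreathLift]

theorem right_wreathLift (θ : CoprodI A →* L) (j : I) (d : D) (x : CoprodI A) :
    (wreathLift θ j d x).right = θ x := by
  have : (RegularWreathProduct.rightHom (D := D)).comp (wreathLift θ j d) = θ := by
    refine ext_hom _ _ fun i => MonoidHom.ext fun a => ?_
    simp [wreathLift_of, wreathTwist]
  exact DFunLike.congr_fun this x

theorem left_wreathLift_of_ne (θ : CoprodI A →* L) {j : I} (d : D) {i : I} (hij : i ≠ j)
    (a : A i) (y : L) : (wreathLift θ j d (of a)).left y = 1 := by
  simp [wreathLift_of, wreathTwist, hij]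

theorem left_wreathLift_of_self [DecidableEq L] (θ : CoprodI A →* L) {j : I} (d : D) (a : A j)
    (y : L) : (wreathLift θ j d (of a)).left y =
      (Pi.mulSingle 1 d : L → D) y * ((Pi.mulSingle 1 d : L → D) ((θ (of a))⁻¹ * y))⁻¹ := by
  simp only [wreathLift_of, wreathTwist, if_true]
  simp
  congr!

theorem left_wreathLift_mul (θ : CoprodI A →* L) (j : I) (d : D) (x x' : CoprodI A) (y : L) :
    (wreathLift θ j d (x * x')).left y =
      (wreathLift θ j d x).left y * (wreathLift θ j d x').left ((θ x)⁻¹ * y) := by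
  rw [map_mul, RegularWreathProduct.mul_left, Pi.mul_apply, right_wreathLift]

/-- The base component of the lift of an alternating product vanishes at the points that the path
of images of its prefixes avoids. -/
theorem left_wreathLift_listProd_eq_one (θ : CoprodI A →* L) (j : I) (d : D) :
    ∀ (l : List (Σ i, A i)) (y : L), IsAlternating l →
      (∀ t, t <+: l → t ≠ [] → θ (listProd t) ≠ y) → (y = 1 → ∀ a ∈ l.head?, a.1 ≠ j) →
      (wreathLift θ j d (listProd l)).left y = 1
  | [], y, _, _, _ => by simp
  | ⟨i, a⟩ :: l, y, hl, hpre, hy => by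
    classical
    have hya : θ (of a) ≠ y := by
      simpa using hpre [⟨i, a⟩] (by simp) (by simp)
    have hya' : (θ (of a))⁻¹ * y ≠ 1 := by rwa [ne_eq, inv_mul_eq_one]
    rw [listProd_cons, left_wreathLift_mul,
      left_wreathLift_listProd_eq_one θ j d l _ hl.tail ?_ fun h => absurd h hya', mul_one]
    · by_cases hij : i = j
      · subst hij
        -- The base component of a letter from `A j` is supported on the endpoints `1` and `θ (of
        -- a)` of its step.
        have hy1 : y ≠ 1 := fun h => hy h _ rfl rfl
        rw [left_wreathLift_of_self, Pi.mulSingle_eq_of_ne hy1, Pi.mulSingle_eq_of_ne hya',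
          one_mul, inv_one]
      · exact left_wreathLift_of_ne θ d hij a y
    · intro t ht hne h
      refine hpre (⟨i, a⟩ :: t) (by simpa using ht) (by simp) ?_
      rw [listProd_cons, map_mul, h, mul_inv_cancel_left]

/-- An element of `N` whose lift has finite order prime to `p` is killed by `θ`. Its lift thus lies
in the base group, where powers are pointwise and `D` has no such torsion. -/
theorem NoCoprimeTorsionOn.wreathLift {p : ℕ} {N : Subgroup (CoprodI A)} {θ : CoprodI A →* L}
    (h : NoCoprimeTorsionOn p N θ) (hD : ∀ (d : D) (n : ℕ), n.Coprime p → d ^ n = 1 → d = 1)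
    (j : I) (d : D) : NoCoprimeTorsionOn p N (wreathLift θ j d) := by
  intro x hx n hn hxn
  have hθ : θ x = 1 := by
    refine h x hx n hn ?_
    rw [← map_pow, ← right_wreathLift θ j d, map_pow, hxn]
    rfl
  have hpow : ∀ (m : ℕ) (y : L), (GroupClass.wreathLift θ j d x ^ m).left y =
      (GroupClass.wreathLift θ j d x).left y ^ m := by
    intro m y
    induction m with
    | zero => simp
    | succ m ih =>
      rw [pow_succ', RegularWreathProduct.mul_left, Pi.mul_apply, right_wreathLift, hθ, inv_one,
        one_mul, ih, pow_succ']
  refine RegularWreathProduct.ext (funext fun y => ?_) ((right_wreathLift θ j d x).trans hθ)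
  refine hD _ n hn ?_
  rw [← hpow, hxn]
  rfl

end WreathLift

/-! ### Residual properties of the free product. -/

variable {C : GroupClass.{u}} {I : Type u} {A : I → Type u} [∀ i, Group (A i)]

/-- Induction on length. A product of earlier quotients gives `θ` nontrivial on the first letter `a`
and on every nonempty prefix of the tail. Hence the path of prefix images leaves `θ (of a)` after
the first step and never returns, so the base component of the lift there is `d⁻¹`. -/
theorem IsRoot.exists_noCoprimeTorsionOn_ker (hC : C.IsRoot) {p : ℕ} (hp : p ∈ C.primes)
    {B : Type u} [Group B] (hB : C B) (ψ : CoprodI A →* B) :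
    ∀ (l : List (Σ i, A i)), l ≠ [] → IsAlternating l → (∀ a ∈ l, ψ (of a.2) ≠ 1) →
      ∃ (L : Type u) (_ : Group L) (θ : CoprodI A →* L),
        C L ∧ NoCoprimeTorsionOn p ψ.ker θ ∧ θ (listProd l) ≠ 1 := by
  obtain ⟨D, _, hDC, hDn, hD⟩ := hC.exists_nontrivial_of_mem_primes hp
  obtain ⟨d, hd⟩ := exists_ne (1 : D)
  suffices H : ∀ (n : ℕ) (l : List (Σ i, A i)), l.length ≤ n → l ≠ [] → IsAlternating l →
      (∀ a ∈ l, ψ (of a.2) ≠ 1) → ∃ (L : Type u) (_ : Group L) (θ : CoprodI A →* L),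
        C L ∧ NoCoprimeTorsionOn p ψ.ker θ ∧ θ (listProd l) ≠ 1 from
    fun l => H _ l le_rfl
  have hψ : NoCoprimeTorsionOn p ψ.ker ψ := fun x hx _ _ _ => hx
  intro n
  induction n with
  | zero =>
    intro l hl hne
    exact absurd (List.length_eq_zero_iff.1 (by omega)) hne
  | succ n ih =>
    rintro (_ | ⟨⟨i, a⟩, l⟩) hlen hne hl hlψ
    · exact absurd rfl hne
    have hlψ' : ∀ b ∈ l, ψ (of b.2) ≠ 1 := fun b hb => hlψ b (List.mem_cons_of_mem _ hb)
    have ha : ψ (of a) ≠ 1 := hlψ _ List.mem_cons_self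
    obtain ⟨L, _, θ, hL, hθ, hsep⟩ := hC.exists_noCoprimeTorsionOn_forall_ne_one (p := p) ψ.ker
      (of a :: (l.inits.filter (· ≠ [])).map listProd) (by
        intro x hx
        rw [List.mem_cons, List.mem_map] at hx
        rcases hx with rfl | ⟨t, ht, rfl⟩
        · exact ⟨B, _, ψ, hB, hψ, ha⟩
        · simp only [List.mem_filter, List.mem_inits, decide_eq_true_eq] at ht
          refine ih t ?_ ht.2 (hl.tail.infix ht.1.isInfix) fun b hb => hlψ' b (ht.1.subset hb)
          have := ht.1.length_le
          simp only [List.length_cons] at hlen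
          omega)
    have hθa : θ (of a) ≠ 1 := hsep _ List.mem_cons_self
    have hθl : ∀ t, t <+: l → t ≠ [] → θ (listProd t) ≠ 1 := by
      intro t ht ht'
      refine hsep _ (List.mem_cons_of_mem _ (List.mem_map_of_mem ?_))
      simpa using ⟨ht, ht'⟩
    refine ⟨D ≀ᵣ L, _, wreathLift θ i d, hC.wreath D L hDC hL, hθ.wreathLift hD i d, fun h1 => ?_⟩
    classical
    have h2 : (wreathLift θ i d (listProd (⟨i, a⟩ :: l))).left (θ (of a)) = 1 := by
      rw [h1]
      rfl
    rw [listProd_cons, left_wreathLift_mul, inv_mul_cancel,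
      left_wreathLift_listProd_eq_one θ i d l 1 hl.tail hθl, left_wreathLift_of_self,
      Pi.mulSingle_eq_of_ne hθa, inv_mul_cancel, Pi.mulSingle_eq_same, mul_one, one_mul,
      inv_eq_one] at h2
    · exact hd h2
    · rintro - b hb
      exact ((List.isChain_cons.1 hl).1 b hb).symm

/-- Finitely many nontrivial letters survive together in some quotient from `C`. -/
theorem IsRoot.exists_hom_forall_of_ne_one (hC : C.IsRoot) (hA : ∀ i, C.Residually (A i))
    (l : List (Σ i, A i)) (hl : ∀ a ∈ l, a.2 ≠ 1) :
    ∃ (B : Type u) (_ : Group B) (ψ : CoprodI A →* B), C B ∧ ∀ a ∈ l, ψ (of a.2) ≠ 1 := by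
  classical
  obtain ⟨B, _, ψ, hB, hψ⟩ := hC.exists_forall_ne_one (l.map fun a => (of a.2 : CoprodI A)) (by
    intro x hx
    obtain ⟨a, ha, rfl⟩ := List.mem_map.1 hx
    obtain ⟨Z, _, σ, hZ, -, hσ⟩ := hA a.1 a.2 (hl a ha)
    refine ⟨Z, _, σ.comp (lift (Pi.mulSingle a.1 (MonoidHom.id (A a.1)))), hZ, ?_⟩
    rwa [MonoidHom.comp_apply, of_leftInverse])
  exact ⟨B, _, ψ, hB, fun a ha => hψ _ (List.mem_map_of_mem ha)⟩

/-- The free product of residually `C`-groups is residually a `C`-group. -/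
theorem IsRoot.residually_coprodI (hC : C.IsRoot) (hA : ∀ i, C.Residually (A i)) :
    C.Residually (CoprodI A) := by
  refine hC.residually_of_forall fun x hx => ?_
  obtain ⟨l, hl, rfl⟩ := exists_isReduced x
  obtain ⟨p, hp⟩ := hC.exists_mem_primes
  obtain ⟨B, _, ψ, hB, hψ⟩ := hC.exists_hom_forall_of_ne_one hA l hl.1
  obtain ⟨L, _, θ, hL, -, hθ⟩ := hC.exists_noCoprimeTorsionOn_ker hp hB ψ l
    (fun h => hx (by rw [h, listProd_nil])) hl.2 hψ
  exact ⟨L, _, θ, hL, hθ⟩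

/-- If the order is `p ^ j * m` with `p ∤ m`, then `y ^ p ^ j` is killed by `m`, hence trivial,
which forces `k ≤ j`. -/
theorem _root_.pow_dvd_orderOf_of_forall_coprime {X : Type*} [Group X] {p : ℕ} (hp : p.Prime)
    (k : ℕ) {y : X} (h : ∀ m n : ℕ, n.Coprime p → (y ^ m) ^ n = 1 → y ^ m = 1)
    (hy : y ^ p ^ k ≠ 1) : p ^ k ∣ orderOf y := by
  rcases eq_or_ne (orderOf y) 0 with h0 | h0
  · rw [h0]
    exact dvd_zero _
  · obtain ⟨j, m, hm, hjm⟩ := Nat.exists_eq_pow_mul_and_not_dvd h0 p hp.ne_one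
    have h1 : y ^ p ^ j = 1 := by
      refine h _ m ((hp.coprime_iff_not_dvd.2 hm).symm) ?_
      rw [← pow_mul, ← hjm, pow_orderOf_eq_one]
    rw [hjm]
    refine (pow_dvd_pow p ?_).mul_right m
    by_contra hlt
    apply hy
    rw [← Nat.add_sub_of_le (not_le.1 hlt).le, pow_add, pow_mul, h1, one_pow]

/-- If `r` has finite order `s` under `ψ`, then its power `r ^ s` lies in `ψ.ker`. A quotient
without torsion prime to `p` there, in which `r ^ (s * p ^ k)` survives, makes `p ^ k` divide the
order of `r ^ s`, hence that of `r`. -/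
theorem IsRoot.exists_pow_dvd_orderOf (hC : C.IsRoot) (hA : ∀ i, C.Residually (A i))
    {r : List (Σ i, A i)} (hr : IsCyclicallyReduced r) {p : ℕ} (hp : p ∈ C.primes) (k : ℕ) :
    ∃ (Z : Type u) (_ : Group Z) (σ : CoprodI A →* Z),
      C Z ∧ p ^ k ∣ orderOf (σ (listProd r)) := by
  obtain ⟨B, _, ψ, hB, hψ⟩ := hC.exists_hom_forall_of_ne_one hA r hr.isReduced.1
  rcases eq_or_ne (orderOf (ψ (listProd r))) 0 with h0 | h0
  · exact ⟨B, _, ψ, hB, by rw [h0]; exact dvd_zero _⟩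
  · have hpk : p ^ k ≠ 0 := pow_ne_zero _ hp.1.ne_zero
    obtain ⟨L, _, θ, hL, hθ, hne⟩ := hC.exists_noCoprimeTorsionOn_ker hp hB ψ
      (List.replicate (orderOf (ψ (listProd r)) * p ^ k) r).flatten
      (hr.flatten_replicate_ne_nil (mul_ne_zero h0 hpk)) (hr.isReduced_flatten_replicate _).2 (by
        intro a ha
        obtain ⟨t, ht, hat⟩ := List.mem_flatten.1 ha
        rw [List.eq_of_mem_replicate ht] at hat
        exact hψ a hat)
    rw [listProd_flatten_replicate, map_pow, pow_mul] at hne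
    refine ⟨L, _, θ, hL, (pow_dvd_orderOf_of_forall_coprime hp.1 k ?_ hne).trans
      (orderOf_pow_dvd _)⟩
    intro m n hn h1
    rw [← map_pow, ← map_pow] at h1 ⊢
    refine hθ _ ?_ n hn h1
    rw [MonoidHom.mem_ker, map_pow, map_pow, pow_orderOf_eq_one, one_pow]

/-! ### Separability and defectiveness of cyclic subgroups. -/

/-- An isolated cyclic subgroup with a cyclically reduced generator is separable. -/
theorem IsRoot.separable_zpowers_listProd (hC : C.IsRoot) (hA : ∀ i, C.Residually (A i))
    {l : List (Σ i, A i)} (hl : IsCyclicallyReduced l)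
    (hiso : C.Isolated (Subgroup.zpowers (listProd l))) :
    C.Separable (Subgroup.zpowers (listProd l)) := by
  refine hC.separable_of_forall fun x hx => ?_
  by_cases hcomm : Commute x (listProd l)
  · obtain ⟨r, a, b, hr, rfl, hb, hlr⟩ := hl.exists_pow_of_commute hcomm
    have hH : Subgroup.zpowers (listProd l) = Subgroup.zpowers (listProd r ^ b) := by
      rcases hlr with h | h
      · rw [h]
      · rw [← h, Subgroup.zpowers_inv]
    rw [hH] at hx hiso ⊢
    have hmem : ∀ m : ℕ, listProd r ^ m ∈ Subgroup.zpowers (listProd r ^ b) ↔ b ∣ m := by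
      intro m
      constructor
      · rintro ⟨n, hn⟩
        have hn' : (listProd r ^ b) ^ n = listProd r ^ m := hn
        rw [← zpow_natCast, ← zpow_natCast, ← zpow_mul,
          zpow_eq_zpow_iff_modEq, hr.orderOf_listProd] at hn'
        rw [Nat.cast_zero, Int.modEq_zero_iff] at hn'
        exact Int.natCast_dvd_natCast.1 ⟨n, hn'.symm⟩
      · rintro ⟨n, rfl⟩
        rw [pow_mul]
        exact pow_mem (Subgroup.mem_zpowers _) n
    rw [hmem] at hx
    have : ∃ p k : ℕ, p.Prime ∧ p ^ k ∣ b ∧ ¬ p ^ k ∣ a := by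
      by_contra! hcon
      exact hx ((Nat.dvd_iff_prime_pow_dvd_dvd a b).2 hcon)
    obtain ⟨p, k, hp, hpb, hpa⟩ := this
    have hpb1 : p ∣ b := by
      refine (dvd_pow_self p ?_).trans hpb
      rintro rfl
      exact hpa (by simp)
    -- Otherwise, with `b = p * c`, isolation would put `r ^ c` into `⟨r ^ b⟩`, so `p * c ∣ c` with
    -- `c > 0`.
    have hpC : p ∈ C.primes := by
      by_contra hpC
      obtain ⟨c, rfl⟩ := hpb1
      have hmc := hiso (listProd r ^ c) p hp hpC (by
        rw [← pow_mul, mul_comm c]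
        exact Subgroup.mem_zpowers _)
      rw [hmem] at hmc
      have hc : 0 < c := Nat.pos_of_ne_zero (right_ne_zero_of_mul hb)
      have := Nat.le_of_dvd hc hmc
      have := hp.two_le
      nlinarith
    obtain ⟨Z, _, σ, hZ, hσ⟩ := hC.exists_pow_dvd_orderOf hA hr hpC k
    refine ⟨Z, _, σ, hZ, ?_⟩
    rintro _ ⟨n, rfl⟩ h
    have h' : σ (listProd r) ^ ((b : ℤ) * n) = σ (listProd r) ^ (a : ℤ) := by
      simpa [zpow_mul] using h
    rw [zpow_eq_zpow_iff_modEq] at h'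
    have h2 := (h'.of_dvd (Int.natCast_dvd_natCast.2 hσ)).dvd
    -- Modulo `p ^ k` the exponent `b * n` vanishes, which would give `p ^ k ∣ a`.
    rw [dvd_sub_left ((Int.natCast_dvd_natCast.2 hpb).mul_right n)] at h2
    exact hpa (Int.natCast_dvd_natCast.1 h2)
  · obtain ⟨Z, _, σ, hZ, hσ⟩ := (hC.residually_coprodI hA).exists_ne hcomm
    refine ⟨Z, _, σ, hZ, ?_⟩
    rintro _ ⟨n, rfl⟩ h
    apply hσ
    -- If `x` had the same image as a power of `h`, the images of `x` and `h` would commute.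
    rw [map_mul, map_mul, ← h, ← map_mul, ← map_mul]
    exact congrArg σ (((Commute.refl (listProd l)).zpow_left n).eq)

/-- A factor embedded by a conjugation is a retract of the free product. -/
theorem IsRoot.defective_map_of_map_conj_iff (hC : C.IsRoot) (hA : ∀ i, C.Residually (A i))
    (i : I) (K : Subgroup (A i)) (c : CoprodI A) :
    C.Defective ((K.map (of : A i →* CoprodI A)).map (MulAut.conj c).toMonoidHom) ↔
      C.Defective K := by
  classical
  rw [Subgroup.map_map]
  refine (hC.residually_coprodI hA).defective_map_iff hC _
    ((lift (Pi.mulSingle i (MonoidHom.id (A i)))).comp (MulAut.conj c)⁻¹.toMonoidHom) ?_ K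
  intro a
  have : (MulAut.conj c)⁻¹ (MulAut.conj c (of a)) = of a :=
    MulAut.inv_apply_self _ (MulAut.conj c) (of a)
  simp only [MonoidHom.comp_apply, MulEquiv.toMonoidHom_eq_coe, MonoidHom.coe_coe, this]
  exact of_leftInverse i a

theorem IsRoot.exists_conj_of_defective (hC : C.IsRoot) (hA : ∀ i, C.Residually (A i))
    {H : Subgroup (CoprodI A)} (hcyc : IsCyclic H) (hH : C.Defective H) :
    ∃ (i : I) (K : Subgroup (A i)) (g : CoprodI A), IsCyclic K ∧ C.Defective K ∧
      H = (K.map (of : A i →* CoprodI A)).map (MulAut.conj g).toMonoidHom := by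
  have hG := hC.residually_coprodI hA
  obtain ⟨h, rfl⟩ := (Subgroup.isCyclic_iff_exists_zpowers_eq_top H).1 hcyc
  rcases exists_conj_of_or_isCyclicallyReduced h with rfl | ⟨i, a, c, rfl⟩ | ⟨l, c, hl, rfl⟩
  · rw [Subgroup.zpowers_one_eq_bot] at hH
    exact absurd hG.separable_bot hH.2
  · have heq : Subgroup.zpowers (c * of a * c⁻¹) =
        ((Subgroup.zpowers a).map (of : A i →* CoprodI A)).map (MulAut.conj c).toMonoidHom := by
      simp [MonoidHom.map_zpowers]
    refine ⟨i, Subgroup.zpowers a, c, inferInstance, ?_, heq⟩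
    rwa [heq, hC.defective_map_of_map_conj_iff hA] at hH
  · have heq : Subgroup.zpowers (c * listProd l * c⁻¹) =
        (Subgroup.zpowers (listProd l)).map (MulAut.conj c).toMonoidHom := by
      simp [MonoidHom.map_zpowers]
    rw [heq, hG.defective_map_iff hC _ (MulAut.conj c)⁻¹.toMonoidHom
      (fun y => MulAut.inv_apply_self _ (MulAut.conj c) y)] at hH
    exact absurd (hC.separable_zpowers_listProd hA hl hH.1) hH.2

end GroupClass

theorem corollary2 (C : GroupClass.{u}) (hC : C.IsRoot) (I : Type u) (A : I → Type u)
    [∀ i, Group (A i)] (hA : ∀ i, C.Residually (A i)) :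
    (∀ H : Subgroup (Monoid.CoprodI A), IsCyclic H →
      (C.Defective H ↔
        ∃ (i : I) (K : Subgroup (A i)) (g : Monoid.CoprodI A),
          IsCyclic K ∧ C.Defective K ∧
            H = (K.map (Monoid.CoprodI.of : A i →* Monoid.CoprodI A)).map
              (MulAut.conj g).toMonoidHom)) ∧
    ((∀ (i : I) (K : Subgroup (A i)), IsCyclic K → C.Isolated K → C.Separable K) →
      ∀ H : Subgroup (Monoid.CoprodI A), IsCyclic H → C.Isolated H → C.Separable H) := by
  refine ⟨fun H hcyc => ⟨hC.exists_conj_of_defective hA hcyc, ?_⟩, fun h H hcyc hiso => ?_⟩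
  · rintro ⟨i, K, g, -, hK, rfl⟩
    exact (hC.defective_map_of_map_conj_iff hA i K g).2 hK
  · by_contra hsep
    obtain ⟨i, K, -, hKc, hK, -⟩ := hC.exists_conj_of_defective hA hcyc ⟨hiso, hsep⟩
    exact hK.2 (h i K hKc hK.1)
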